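/- Let $\mathbb{F}$ be a skew-field and let $G$ be a locally indicable group (every nontrivial finitely generated subgroup of $G$ admits an epimorphism onto $\mathbb{Z}$). Suppose that the group ring $\mathbb{F}G$ has a Hughes-free division ring $\mathcal{D}_{\mathbb{F}G}$, that is, a skew-field $\mathcal{D}_{\mathbb{F}G}$ together with a ring homomorphism $\varphi\colon \mathbb{F}G\to\mathcal{D}_{\mathbb{F}G}$ such that (1) $\mathcal{D}_{\mathbb{F}G}$ is generated as a skew-field by $\varphi(\mathbb{F}G)$; and (2) for every nontrivial finitely generated subgroup $H\leqslant G$, every normal subgroup $N\trianglelefteq H$ with $H/N\cong\mathbb{Z}$, and all $h_1,\dots,h_n\in H$ lying in pairwise distinct cosets of $N$, the sum $\langle\varphi(\mathbb{F}N)\rangle\varphi(h_1)+\cdots+\langle\varphi(\mathbb{F}N)\rangle\varphi(h_n)$ is direct, where $\langle\varphi(\mathbb{F}N)\rangle$ denotes the sub-skew-field of $\mathcal{D}_{\mathbb{F}G}$ generated by $\varphi(\mathbb{F}N)$. Let $1\to K\to G\to\mathbb{Z}\to 1$ be a short exact sequence of groups, and let $\mathcal{D}_{\mathbb{F}K}=\langle\varphi(\mathbb{F}K)\rangle\subseteq\mathcal{D}_{\mathbb{F}G}$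 be the sub-skew-field generated by $\varphi(\mathbb{F}K)$, which is a Hughes-free division ring of $\mathbb{F}K$. For $A\in\{G,K\}$ and $p\geqslant 0$ put $$b_p^{\mathcal{D}_{\mathbb{F}A}}(A)=\dim_{\mathcal{D}_{\mathbb{F}A}}\operatorname{Tor}_p^{\mathbb{F}A}(\mathbb{F},\mathcal{D}_{\mathbb{F}A})\in\{0,1,2,\dots\}\cup\{\infty\},$$ where $\mathbb{F}$ is the trivial $\mathbb{F}A$-module, $\mathcal{D}_{\mathbb{F}A}$ is a $\mathcal{D}_{\mathbb{F}A}$-$\mathbb{F}A$-bimodule via $\varphi$, and the Tor-module is the $p$-th homology of $\mathcal{D}_{\mathbb{F}A}\otimes_{\mathbb{F}A}F_\bullet$ for a projective resolution $F_\bullet\to\mathbb{F}$ by left $\mathbb{F}A$-modules. If $b_p^{\mathcal{D}_{\mathbb{F}K}}(K)<\infty$ for some $p\geqslant 0$, then $b_p^{\mathcal{D}_{\mathbb{F}G}}(G)=0$. -/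

import Mathlib

open CategoryTheory

open scoped TensorProduct

universe u v w x

noncomputable section

namespace HughesFree

/-! ### Extension of scalars along a homomorphism of not necessarily commutative rings -/

section ExtendScalars

variable {R : Type u} {D : Type w} [Ring R] [Ring D] (φ : R →+* D)

/-- The left `D`-submodule of `D ⊗_ℤ M` generated by the elements
`d φ(r) ⊗ m - d ⊗ r m`. -/
def balancing (M : Type x) [AddCommGroup M] [Module R M] : Submodule D (D ⊗[ℤ] M) :=
  Submodule.span D
    {z | ∃ (d : D) (r : R) (m : M), z = (d * φ r) ⊗ₜ[ℤ] m - d ⊗ₜ[ℤ] (r • m)}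

/-- The left `D`-module `D ⊗_R M`, where `D` is a `D`-`R`-bimodule through `φ : R → D` and
`M` is a left `R`-module. -/
abbrev BalancedTensor (M : Type x) [AddCommGroup M] [Module R M] : Type max w x :=
  (D ⊗[ℤ] M) ⧸ balancing φ M

variable {M : Type x} [AddCommGroup M] [Module R M]
variable {N : Type x} [AddCommGroup N] [Module R N]

/-- The `D`-linear map `D ⊗_ℤ M → D ⊗_ℤ N` induced by an `R`-linear map `M → N`. -/
def tensorMap (D : Type w) [Ring D] (f : M →ₗ[R] N) : (D ⊗[ℤ] M) →ₗ[D] (D ⊗[ℤ] N) :=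
  TensorProduct.AlgebraTensorModule.map LinearMap.id f.toAddMonoidHom.toIntLinearMap

@[simp]
theorem tensorMap_tmul (f : M →ₗ[R] N) (d : D) (m : M) :
    tensorMap D f (d ⊗ₜ[ℤ] m) = d ⊗ₜ[ℤ] f m := rfl

theorem balancing_le_comap (f : M →ₗ[R] N) :
    balancing φ M ≤ (balancing φ N).comap (tensorMap D f) := by
  refine Submodule.span_le.2 ?_
  rintro _ ⟨d, r, m, rfl⟩
  refine Submodule.subset_span ⟨d, r, f m, ?_⟩
  simp

/-- The `D`-linear map `D ⊗_R M → D ⊗_R N` induced by an `R`-linear map `M → N`. -/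
def balancedMap (f : M →ₗ[R] N) : BalancedTensor φ M →ₗ[D] BalancedTensor φ N :=
  Submodule.mapQ _ _ (tensorMap D f) (balancing_le_comap φ f)

theorem balanced_hom_ext {P : Type*} [AddCommGroup P] [Module D P]
    {f g : BalancedTensor φ M →ₗ[D] P}
    (h : ∀ (d : D) (m : M), f (Submodule.Quotient.mk (d ⊗ₜ[ℤ] m)) =
      g (Submodule.Quotient.mk (d ⊗ₜ[ℤ] m))) : f = g := by
  refine Submodule.linearMap_qext _ (LinearMap.ext fun z => ?_)
  induction z using TensorProduct.induction_on with
  | zero => simp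
  | tmul d m => exact h d m
  | add a b ha hb => rw [map_add, map_add, ha, hb]

@[simp]
theorem balancedMap_mk_tmul (f : M →ₗ[R] N) (d : D) (m : M) :
    balancedMap φ f (Submodule.Quotient.mk (d ⊗ₜ[ℤ] m)) =
      Submodule.Quotient.mk (d ⊗ₜ[ℤ] f m) := rfl

/-- The functor `D ⊗_R -` from left `R`-modules to left `D`-modules. -/
def tensorFunctor : ModuleCat.{x} R ⥤ ModuleCat.{max w x} D where
  obj M := ModuleCat.of D (BalancedTensor φ M)
  map f := ModuleCat.ofHom (balancedMap φ f.hom)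
  map_id M := by
    refine ModuleCat.hom_ext (balanced_hom_ext φ fun d m => ?_)
    simp
  map_comp f g := by
    refine ModuleCat.hom_ext (balanced_hom_ext φ fun d m => ?_)
    simp

instance tensorFunctor_additive : (tensorFunctor.{u, w, x} φ).Additive where
  map_add {M N f g} := by
    refine ModuleCat.hom_ext (balanced_hom_ext φ fun d m => ?_)
    change Submodule.Quotient.mk (p := balancing φ N) (d ⊗ₜ[ℤ] (f.hom m + g.hom m)) =
      Submodule.Quotient.mk (p := balancing φ N) (d ⊗ₜ[ℤ] f.hom m) +
        Submodule.Quotient.mk (p := balancing φ N) (d ⊗ₜ[ℤ] g.hom m)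
    rw [TensorProduct.tmul_add, Submodule.Quotient.mk_add]

end ExtendScalars

/-! ### Homology and Betti numbers of a group with coefficients in a skew-field -/

section Betti

variable (F : Type u) (G : Type v) [DivisionRing F] [Group G]

/-- The augmentation `F[G] → F`. -/
def augmentation : MonoidAlgebra F G →+* F :=
  MonoidAlgebra.liftNCRingHom (RingHom.id F) (1 : G →* F) fun _ _ => Commute.one_right _

/-- The trivial left `F[G]`-module `F` (lifted to the universe of `F[G]`). -/
def trivialModule : ModuleCat.{max u v} (MonoidAlgebra F G) :=
  (ModuleCat.restrictScalars (augmentation F G)).obj (ModuleCat.of F (ULift.{v} F))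

variable {F G} {D : Type w} [DivisionRing D]

/-- `H_p(G; D) = Tor_p^{F[G]}(F, D)`, as a left `D`-module: the value at the trivial module `F`
of the `p`-th left derived functor of `D ⊗_{F[G]} -`. -/
def homology (φ : MonoidAlgebra F G →+* D) (p : ℕ) : ModuleCat.{max u v w} D :=
  ((tensorFunctor.{max u v, w, max u v} φ).leftDerived p).obj (trivialModule F G)

/-- The `p`-th Betti number `dim_D H_p(G; D)`, a natural number or `∞`. -/
def betti (φ : MonoidAlgebra F G →+* D) (p : ℕ) : ℕ∞ :=
  Cardinal.toENat (Module.rank D (homology φ p))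

end Betti

/-! ### Hughes-free division rings -/

/-- A group is locally indicable if each of its nontrivial finitely generated subgroups admits
an epimorphism onto `ℤ`. -/
def LocallyIndicable (G : Type v) [Group G] : Prop :=
  ∀ H : Subgroup G, H.FG → H ≠ ⊥ →
    ∃ f : H →* Multiplicative ℤ, Function.Surjective f

section Generated

variable {R : Type u} {D : Type w} [Ring R] [DivisionRing D]

/-- The sub-skew-field `⟨φ(R)⟩` of `D` generated by the image of `φ : R → D`. -/
def generated (φ : R →+* D) : Subfield D :=
  Subfield.closure (Set.range φ)

/-- The homomorphism `φ : R → D`, regarded as a map to `⟨φ(R)⟩`. -/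
def toGenerated (φ : R →+* D) : R →+* generated φ :=
  φ.codRestrict (generated φ) fun r => Subfield.subset_closure ⟨r, rfl⟩

end Generated

section HughesFree

variable {F : Type u} {G : Type v} {D : Type w} [DivisionRing F] [Group G] [DivisionRing D]

/-- The restriction of `φ : F[G] → D` along a group homomorphism `K → G`. -/
def restrict (φ : MonoidAlgebra F G →+* D) {K : Type x} [Group K] (ι : K →* G) :
    MonoidAlgebra F K →+* D :=
  φ.comp (MonoidAlgebra.mapDomainRingHom F ι)

/-- The pair `(D, φ)` is Hughes-free: `D` is generated by `φ(F[G])` as a skew-field, and for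
every nontrivial finitely generated subgroup `H`, every normal subgroup `N` of `H` with `H/N`
infinite cyclic, and all `h₁, …, hₙ` in `H` lying in pairwise distinct cosets of `N`, the sum
`⟨φ(F[N])⟩ φ(h₁) + ⋯ + ⟨φ(F[N])⟩ φ(hₙ)` is direct. -/
structure IsHughesFree (φ : MonoidAlgebra F G →+* D) : Prop where
  generated_eq_top : generated φ = ⊤
  direct : ∀ H : Subgroup G, H.FG → H ≠ ⊥ →
    ∀ (N : Subgroup H) [N.Normal], Nonempty (H ⧸ N ≃* Multiplicative ℤ) →
    ∀ (n : ℕ) (h : Fin n → H), Function.Injective (fun i => (h i : H ⧸ N)) →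
    ∀ a : Fin n → D, (∀ i, a i ∈ generated (restrict φ (H.subtype.comp N.subtype))) →
      ∑ i, a i * φ (MonoidAlgebra.of F G (h i)) = 0 →
      ∀ i, a i * φ (MonoidAlgebra.of F G (h i)) = 0

theorem map_generated {R : Type*} [Ring R] {E : Type*} [DivisionRing E] (ψ : R →+* D)
    (f : D →+* E) : (generated ψ).map f = generated (f.comp ψ) := by
  rw [generated, generated, RingHom.map_field_closure, RingHom.coe_comp, Set.range_comp]

/-- If `(D, φ)` is Hughes-free and `K` embeds into `G`, then the sub-skew-field of `D` generated
by `φ(F[K])` is a Hughes-free division ring of `F[K]`. -/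
theorem IsHughesFree.restrict {φ : MonoidAlgebra F G →+* D} (hφ : IsHughesFree φ)
    {K : Type x} [Group K] (ι : K →* G) (hι : Function.Injective ι) :
    IsHughesFree (toGenerated (restrict φ ι)) := by
  set ψ := HughesFree.restrict φ ι with hψ
  have hsub : (generated ψ).subtype.comp (toGenerated ψ) = ψ := rfl
  refine ⟨?_, ?_⟩
  · rw [eq_top_iff]
    rintro ⟨d, hd⟩ -
    have h2 : d ∈ (generated (toGenerated ψ)).map (generated ψ).subtype := by
      rw [map_generated, hsub]; exact hd
    obtain ⟨y, hy, rfl⟩ := h2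
    exact hy
  · intro H hH hne N hN hZ n h hinj a ha hsum i
    obtain ⟨q⟩ := hZ
    let e : H ≃* H.map ι := H.equivMapOfInjective ι hι
    let N' : Subgroup (H.map ι) := N.map e.toMonoidHom
    have hN' : N'.Normal := hN.map e.toMonoidHom e.surjective
    let c : H ⧸ N ≃* H.map ι ⧸ N' := QuotientGroup.congr N N' e rfl
    have hof : ∀ i, φ (MonoidAlgebra.of F G (e (h i))) =
        (toGenerated ψ (MonoidAlgebra.of F K (h i)) : D) := by
      intro i
      change _ = φ (MonoidAlgebra.mapDomainRingHom F ι (MonoidAlgebra.of F K (h i)))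
      simp [e]
    have hfg : (H.map ι).FG := by
      classical
      obtain ⟨S, rfl⟩ := hH
      exact ⟨S.image ι, by rw [Finset.coe_image, MonoidHom.map_closure]⟩
    have key := hφ.direct (H.map ι) hfg (by
        rw [Ne, Subgroup.map_eq_bot_iff_of_injective _ hι]; exact hne) N' ⟨c.symm.trans q⟩ n
      (fun i => e (h i)) (by
        intro i j hij
        exact hinj (c.injective hij))
      (fun i => (a i : D)) (by
        intro i
        have h1 : (a i : D) ∈ (generated (HughesFree.restrict (toGenerated ψ)
            (H.subtype.comp N.subtype))).map (generated ψ).subtype := ⟨a i, ha i, rfl⟩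
        rw [map_generated] at h1
        refine Subfield.closure_mono ?_ h1
        rintro _ ⟨z, rfl⟩
        let eN : N →* N' := (e.toMonoidHom.comp N.subtype).codRestrict N'
          fun y => ⟨y, y.2, rfl⟩
        refine ⟨MonoidAlgebra.mapDomainRingHom F eN z, ?_⟩
        change φ _ = φ _
        congr 1
        change ((MonoidAlgebra.mapDomainRingHom F ((H.map ι).subtype.comp N'.subtype)).comp
          (MonoidAlgebra.mapDomainRingHom F eN)) z = ((MonoidAlgebra.mapDomainRingHom F ι).comp
            (MonoidAlgebra.mapDomainRingHom F (H.subtype.comp N.subtype))) z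
        rw [← MonoidAlgebra.mapDomainRingHom_comp, ← MonoidAlgebra.mapDomainRingHom_comp]
        rfl) (by
        have := congrArg (generated ψ).subtype hsum
        rw [map_sum, map_zero] at this
        rw [← this]
        exact Finset.sum_congr rfl fun i _ => by rw [hof]; rfl) i
    apply Subtype.ext
    rw [hof] at key
    exact key

end HughesFree

end HughesFree

end

/-! Write `E` for the skew-field generated by `φ(F[K])`, and `τ = φ(t)` with `t` lifting a generator
of `ℤ`. Conjugation by `τ` preserves `E`, and Hughes-freeness makes the powers of `τ` independent
over `E` (`IsHughesFree.linearIndependent_zpow`). So `laurentSpan E τ` is a twisted Laurent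
polynomial ring. It is an Ore domain by a dimension count, and `D` consists of its left fractions
(`laurentSpan_ore`, `exists_denominator`).

Since `F[G]` is free over `F[K]` on the powers of `t`, a projective resolution `P` of the trivial
`F[G]`-module also computes the homology of `K`. The natural map `E ⊗ P → D ⊗ P`, with tensor
products over `F[K]` and `F[G]`, is injective (`comparison_injective`). Its image, the `E`-span of
the elements `1 ⊗ m`, is stable under `τ`.

Let `z` be a `p`-cycle of `D ⊗ P`. Some nonzero `a` moves `z` into this image, so all `τ ^ i • a •
z` come from cycles of `E ⊗ P`. As `H_p(K; E)` is finite-dimensional, a nontrivial combination of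
these is a boundary: `(q * a) • z` is a boundary with `q = ∑ e_i τ ^ i`. Independence of the powers
gives `q ≠ 0`, and dividing by `q * a` shows that `z` is a boundary (`exact_of_finite_homology`). -/

noncomputable section

namespace HughesFree

/-! ### Twisted Laurent polynomials inside a skew-field -/

section Laurent

variable {D : Type w} [DivisionRing D] (E : Subfield D) (τ : D)

/-- The `E`-span of the powers of `τ`: the image in `D` of a twisted Laurent polynomial ring when
conjugation by `τ` preserves `E`. -/
def laurentSpan : Submodule E D :=
  Submodule.span E (Set.range fun i : ℤ => τ ^ i)

variable {E τ}

theorem zpow_mem_laurentSpan (i : ℤ) : τ ^ i ∈ laurentSpan E τ :=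
  Submodule.subset_span ⟨i, rfl⟩

theorem one_mem_laurentSpan : (1 : D) ∈ laurentSpan E τ := by
  simpa using zpow_mem_laurentSpan (E := E) (τ := τ) 0

section Module

variable {V : Type*} [AddCommGroup V] [Module D V]

theorem laurentSpan_smul_mem {L : Submodule E V} (hL : ∀ (i : ℤ), ∀ l ∈ L, τ ^ i • l ∈ L)
    {a : D} (ha : a ∈ laurentSpan E τ) {l : V} (hl : l ∈ L) : a • l ∈ L := by
  induction ha using Submodule.span_induction with
  | mem y hy =>
    obtain ⟨i, rfl⟩ := hy
    exact hL i l hl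
  | zero => simp
  | add y z _ _ hy hz => rw [add_smul]; exact L.add_mem hy hz
  | smul e y _ hy =>
    rw [Subfield.smul_def, smul_eq_mul, mul_smul, ← Subfield.smul_def]
    exact L.smul_mem e hy

/-- Moving `τ ^ i` past a scalar of `E` only conjugates the scalar, so stability under `τ` need only
be checked on generators. -/
theorem zpow_smul_mem_span (hτ : τ ≠ 0) (hconj : ∀ (i : ℤ), ∀ e ∈ E, τ ^ i * e * (τ ^ i)⁻¹ ∈ E)
    {X : Set V} (hX : ∀ (i : ℤ), ∀ x ∈ X, τ ^ i • x ∈ Submodule.span E X) (i : ℤ) {l : V}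
    (hl : l ∈ Submodule.span E X) : τ ^ i • l ∈ Submodule.span E X := by
  induction hl using Submodule.span_induction with
  | mem y hy => exact hX i y hy
  | zero => simp
  | add y z _ _ hy hz => rw [smul_add]; exact Submodule.add_mem _ hy hz
  | smul e y _ hy =>
    have h : τ ^ i • e • y = (⟨_, hconj i e e.2⟩ : E) • τ ^ i • y := by
      rw [Subfield.smul_def, Subfield.smul_def, smul_smul, smul_smul,
        inv_mul_cancel_right₀ (zpow_ne_zero i hτ)]
    rw [h]
    exact Submodule.smul_mem _ _ hy

end Module

theorem laurentSpan_mul_mem (hτ : τ ≠ 0)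
    (hconj : ∀ (i : ℤ), ∀ e ∈ E, τ ^ i * e * (τ ^ i)⁻¹ ∈ E) {a b : D}
    (ha : a ∈ laurentSpan E τ) (hb : b ∈ laurentSpan E τ) : a * b ∈ laurentSpan E τ := by
  refine laurentSpan_smul_mem (fun i l hl => zpow_smul_mem_span hτ hconj ?_ i hl) ha hb
  rintro i _ ⟨j, rfl⟩
  refine Submodule.subset_span ⟨i + j, ?_⟩
  simp [zpow_add₀ hτ]

theorem exists_mem_span_zpow_Icc {a : D} (ha : a ∈ laurentSpan E τ) :
    ∃ m : ℕ, ∀ k : ℕ, m ≤ k →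
      a ∈ Submodule.span E ((fun i : ℤ => τ ^ i) '' Set.Icc (-k : ℤ) k) := by
  induction ha using Submodule.span_induction with
  | mem y hy =>
    obtain ⟨i, rfl⟩ := hy
    refine ⟨i.natAbs, fun k hk => Submodule.subset_span ⟨i, ?_, rfl⟩⟩
    simp only [Set.mem_Icc]; omega
  | zero => exact ⟨0, fun k _ => Submodule.zero_mem _⟩
  | add y z _ _ hy hz =>
    obtain ⟨m, hm⟩ := hy
    obtain ⟨n, hn⟩ := hz
    exact ⟨max m n, fun k hk => Submodule.add_mem _ (hm k (by omega)) (hn k (by omega))⟩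
  | smul e y _ hy =>
    obtain ⟨m, hm⟩ := hy
    exact ⟨m, fun k hk => Submodule.smul_mem _ _ (hm k hk)⟩

theorem zpow_mul_mem_span_Icc (hτ : τ ≠ 0)
    (hconj : ∀ (i : ℤ), ∀ e ∈ E, τ ^ i * e * (τ ^ i)⁻¹ ∈ E) {k l i k' l' : ℤ} {a : D}
    (ha : a ∈ Submodule.span E ((fun i : ℤ => τ ^ i) '' Set.Icc k l))
    (hk : k' ≤ i + k) (hl : i + l ≤ l') :
    τ ^ i * a ∈ Submodule.span E ((fun i : ℤ => τ ^ i) '' Set.Icc k' l') := by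
  induction ha using Submodule.span_induction with
  | mem y hy =>
    obtain ⟨j, hj, rfl⟩ := hy
    simp only [Set.mem_Icc] at hj
    refine Submodule.subset_span ⟨i + j, ?_, zpow_add₀ hτ i j⟩
    simp only [Set.mem_Icc]; omega
  | zero => simp
  | add y z _ _ hy hz => rw [mul_add]; exact Submodule.add_mem _ hy hz
  | smul e y _ hy =>
    have h : τ ^ i * e • y = (⟨_, hconj i e e.2⟩ : E) • (τ ^ i * y) := by
      rw [Subfield.smul_def, Subfield.smul_def, smul_eq_mul, smul_eq_mul, ← mul_assoc,
        ← mul_assoc, inv_mul_cancel_right₀ (zpow_ne_zero i hτ)]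
    rw [h]
    exact Submodule.smul_mem _ _ hy

/-- The twisted Laurent polynomial ring `laurentSpan E τ` satisfies the left Ore condition. -/
theorem laurentSpan_ore (hτ : τ ≠ 0)
    (hconj : ∀ (i : ℤ), ∀ e ∈ E, τ ^ i * e * (τ ^ i)⁻¹ ∈ E)
    (hind : LinearIndependent E fun i : ℤ => τ ^ i) {a b : D}
    (ha : a ∈ laurentSpan E τ) (hb : b ∈ laurentSpan E τ) (hb0 : b ≠ 0) :
    ∃ c ∈ laurentSpan E τ, ∃ d ∈ laurentSpan E τ, c ≠ 0 ∧ c * a = d * b := by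
  classical
  obtain ⟨m, hm⟩ := exists_mem_span_zpow_Icc ha
  obtain ⟨m', hm'⟩ := exists_mem_span_zpow_Icc hb
  set k := max m m' with hk
  -- The products `τ ^ i * a` and `τ ^ i * b` with `i < n` are `2 * n` vectors in a space spanned by
  -- `n + 2 * k` powers of `τ`. They are dependent once `n > 2 * k`.
  let n := 2 * k + 1
  let W : Submodule E D := Submodule.span E
    (((Finset.Icc (-k : ℤ) (n + k - 1)).image fun i : ℤ => τ ^ i : Finset D) : Set D)
  have hW : Module.finrank E W < Fintype.card (Fin n ⊕ Fin n) := by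
    refine (finrank_span_finset_le_card _).trans_lt (Finset.card_image_le.trans_lt ?_)
    simp only [Int.card_Icc, Fintype.card_sum, Fintype.card_fin]
    omega
  have hmem : ∀ {y : D}, y ∈ Submodule.span E ((fun i : ℤ => τ ^ i) '' Set.Icc (-k : ℤ) k) →
      ∀ i : Fin n, τ ^ ((i : ℕ) : ℤ) * y ∈ W := by
    intro y hy i
    have := zpow_mul_mem_span_Icc hτ hconj (i := ((i : ℕ) : ℤ)) (k' := (-k : ℤ))
      (l' := (n + k - 1 : ℤ)) hy (by omega) (by have := i.2; omega)
    simpa only [W, Finset.coe_image, Finset.coe_Icc] using this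
  let f : Fin n ⊕ Fin n → W := Sum.elim
    (fun i => ⟨_, hmem (hm k (by omega)) i⟩) (fun i => ⟨_, hmem (hm' k (by omega)) i⟩)
  have hf : ¬ LinearIndependent E f := fun h => by
    have : Module.Finite E W := Module.Finite.span_finset _ _
    exact absurd h.fintype_card_le_finrank (not_le.2 hW)
  rw [Fintype.not_linearIndependent_iff] at hf
  obtain ⟨g, hg, i₀, hi₀⟩ := hf
  have hsum : (∑ i, g (Sum.inl i) • τ ^ ((i : ℕ) : ℤ)) * a +
      (∑ i, g (Sum.inr i) • τ ^ ((i : ℕ) : ℤ)) * b = 0 := by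
    have := congrArg W.subtype hg
    rw [Fintype.sum_sum_type, map_add, map_sum, map_sum, map_zero] at this
    rw [← this, Finset.sum_mul, Finset.sum_mul]
    congr 1 <;> exact Finset.sum_congr rfl fun i _ => smul_mul_assoc _ _ _
  have hmemS : ∀ c : Fin n → E, ∑ i, c i • τ ^ ((i : ℕ) : ℤ) ∈ laurentSpan E τ := fun c =>
    Submodule.sum_mem _ fun i _ => Submodule.smul_mem _ _ (zpow_mem_laurentSpan _)
  have hzero : ∀ c : Fin n → E, ∑ i, c i • τ ^ ((i : ℕ) : ℤ) = 0 → ∀ i, c i = 0 := by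
    refine Fintype.linearIndependent_iff.1 (hind.comp (fun i : Fin n => ((i : ℕ) : ℤ)) ?_)
    intro i j hij
    exact Fin.ext (by simpa using hij)
  refine ⟨_, hmemS fun i => g (Sum.inl i), _, Submodule.neg_mem _ (hmemS fun i => g (Sum.inr i)),
    fun h0 => ?_, ?_⟩
  -- If the left multiplier vanished, so would the right one, because `b ≠ 0`; then every
  -- coefficient of the relation would be zero.
  · rw [h0, zero_mul, zero_add] at hsum
    have h1 := (mul_eq_zero.1 hsum).resolve_right hb0
    rcases i₀ with i | i
    · exact hi₀ (hzero _ h0 i)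
    · exact hi₀ (hzero _ h1 i)
  · rw [neg_mul]
    exact eq_neg_of_add_eq_zero_left hsum

/-- Every element of the skew-field generated by `E` and `τ` is a left fraction of elements of
`laurentSpan E τ`. -/
theorem exists_denominator (hτ : τ ≠ 0)
    (hconj : ∀ (i : ℤ), ∀ e ∈ E, τ ^ i * e * (τ ^ i)⁻¹ ∈ E)
    (hind : LinearIndependent E fun i : ℤ => τ ^ i) {s : Set D}
    (hs : s ⊆ laurentSpan E τ) {d : D} (hd : d ∈ Subfield.closure s) :
    ∃ a ∈ laurentSpan E τ, a ≠ 0 ∧ a * d ∈ laurentSpan E τ := by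
  induction hd using Subfield.closure_induction with
  | mem y hy => exact ⟨1, one_mem_laurentSpan, one_ne_zero, by simpa using hs hy⟩
  | one => exact ⟨1, one_mem_laurentSpan, one_ne_zero, by simpa using one_mem_laurentSpan⟩
  | add y z _ _ hy hz =>
    obtain ⟨a, ha, ha0, hay⟩ := hy
    obtain ⟨b, hb, hb0, hbz⟩ := hz
    obtain ⟨c, hc, d, hd, hc0, h⟩ := laurentSpan_ore hτ hconj hind ha hb hb0
    refine ⟨c * a, laurentSpan_mul_mem hτ hconj hc ha, mul_ne_zero hc0 ha0, ?_⟩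
    rw [mul_add, mul_assoc c a y, h, mul_assoc d b z]
    exact Submodule.add_mem _ (laurentSpan_mul_mem hτ hconj hc hay)
      (laurentSpan_mul_mem hτ hconj hd hbz)
  | neg y _ hy =>
    obtain ⟨a, ha, ha0, hay⟩ := hy
    exact ⟨a, ha, ha0, by rw [mul_neg]; exact Submodule.neg_mem _ hay⟩
  | inv y _ hy =>
    obtain ⟨a, ha, ha0, hay⟩ := hy
    by_cases hy0 : y = 0
    · exact ⟨1, one_mem_laurentSpan, one_ne_zero, by simp [hy0]⟩
    -- The numerator of `y` serves as a denominator of its inverse.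
    · exact ⟨a * y, hay, mul_ne_zero ha0 hy0, by rwa [mul_inv_cancel_right₀ hy0]⟩
  | mul y z _ _ hy hz =>
    obtain ⟨a, ha, ha0, hay⟩ := hy
    obtain ⟨b, hb, hb0, hbz⟩ := hz
    -- The Ore condition moves the denominator `b` of `z` to the left past the numerator `a * y`.
    obtain ⟨c, hc, d, hd, hc0, h⟩ := laurentSpan_ore hτ hconj hind hay hb hb0
    refine ⟨c * a, laurentSpan_mul_mem hτ hconj hc ha, mul_ne_zero hc0 ha0, ?_⟩
    have : c * a * (y * z) = d * (b * z) := by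
      rw [← mul_assoc d, ← h, mul_assoc, mul_assoc, mul_assoc]
    rw [this]
    exact laurentSpan_mul_mem hτ hconj hd hbz

end Laurent

/-! ### Hughes-freeness for an infinite cyclic quotient -/

section Cyclic

variable {F : Type u} {G K : Type v} {D : Type w} [DivisionRing F] [Group G] [Group K]
  [DivisionRing D] (φ : MonoidAlgebra F G →+* D) (ι : K →* G)

theorem map_of_ne_zero (g : G) : φ (MonoidAlgebra.of F G g) ≠ 0 := by
  intro h
  have h1 : φ (MonoidAlgebra.of F G g) * φ (MonoidAlgebra.of F G g⁻¹) = 1 := by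
    rw [← map_mul, ← map_mul, mul_inv_cancel, map_one, map_one]
  rw [h, zero_mul] at h1
  exact zero_ne_one h1

theorem map_of_zpow (g : G) (i : ℤ) :
    φ (MonoidAlgebra.of F G (g ^ i)) = φ (MonoidAlgebra.of F G g) ^ i :=
  map_zpow (φ.toMonoidHom.comp (MonoidAlgebra.of F G)) g i

theorem restrict_single (k : K) (a : F) :
    restrict φ ι (MonoidAlgebra.single k a) = φ (MonoidAlgebra.single (ι k) a) := by
  simp [restrict]

theorem restrict_mem_generated (z : MonoidAlgebra F K) :
    restrict φ ι z ∈ generated (restrict φ ι) :=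
  Subfield.subset_closure ⟨z, rfl⟩

variable {φ ι}

/-- An element of the skew-field generated by `φ(F[K])` lies in the skew-field generated by
`φ(F[L])` for each `L` containing suitable finitely many elements of `K`. -/
theorem exists_finset_mem_generated {e : D} (he : e ∈ generated (restrict φ ι)) :
    ∃ s : Finset K, ∀ {L : Type v} [Group L] (κ : L →* G), (∀ k ∈ s, ι k ∈ κ.range) →
      e ∈ generated (restrict φ κ) := by
  classical
  induction he using Subfield.closure_induction with
  | mem y hy =>
    obtain ⟨z, rfl⟩ := hy
    induction z using MonoidAlgebra.induction_linear with
    | zero => exact ⟨∅, fun κ _ => by rw [map_zero]; exact zero_mem _⟩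
    | add y z hy hz =>
      obtain ⟨s, hs⟩ := hy
      obtain ⟨s', hs'⟩ := hz
      refine ⟨s ∪ s', fun κ h => ?_⟩
      rw [map_add]
      exact add_mem (hs κ fun k hk => h k (Finset.mem_union_left _ hk))
        (hs' κ fun k hk => h k (Finset.mem_union_right _ hk))
    | single k a =>
      refine ⟨{k}, fun κ h => ?_⟩
      obtain ⟨l, hl⟩ := h k (Finset.mem_singleton_self k)
      rw [restrict_single, ← hl, ← restrict_single]
      exact restrict_mem_generated φ κ _
  | one => exact ⟨∅, fun κ _ => one_mem _⟩
  | add y z _ _ hy hz =>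
    obtain ⟨s, hs⟩ := hy
    obtain ⟨s', hs'⟩ := hz
    exact ⟨s ∪ s', fun κ h => add_mem (hs κ fun k hk => h k (Finset.mem_union_left _ hk))
        (hs' κ fun k hk => h k (Finset.mem_union_right _ hk))⟩
  | neg y _ hy =>
    obtain ⟨s, hs⟩ := hy
    exact ⟨s, fun κ h => neg_mem (hs κ h)⟩
  | inv y _ hy =>
    obtain ⟨s, hs⟩ := hy
    exact ⟨s, fun κ h => inv_mem (hs κ h)⟩
  | mul y z _ _ hy hz =>
    obtain ⟨s, hs⟩ := hy
    obtain ⟨s', hs'⟩ := hz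
    exact ⟨s ∪ s', fun κ h => mul_mem (hs κ fun k hk => h k (Finset.mem_union_left _ hk))
        (hs' κ fun k hk => h k (Finset.mem_union_right _ hk))⟩

theorem conj_mem_generated (hK : ι.range.Normal) (g : G) {e : D}
    (he : e ∈ generated (restrict φ ι)) :
    φ (MonoidAlgebra.of F G g) * e * (φ (MonoidAlgebra.of F G g))⁻¹ ∈
      generated (restrict φ ι) := by
  have hne := map_of_ne_zero φ g
  set γ := φ (MonoidAlgebra.of F G g) with hγ
  induction he using Subfield.closure_induction with
  | mem y hy =>
    obtain ⟨z, rfl⟩ := hy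
    induction z using MonoidAlgebra.induction_linear with
    | zero => rw [map_zero, mul_zero, zero_mul]; exact zero_mem _
    | add y z hy hz => rw [map_add, mul_add, add_mul]; exact add_mem hy hz
    | single k a =>
      obtain ⟨l, hl⟩ := hK.conj_mem (ι k) ⟨k, rfl⟩ g
      have h : γ * restrict φ ι (MonoidAlgebra.single k a) * γ⁻¹ =
          restrict φ ι (MonoidAlgebra.single l a) := by
        rw [mul_inv_eq_iff_eq_mul₀ hne, restrict_single, restrict_single, hl, hγ, ← map_mul,
          ← map_mul]
        simp [MonoidAlgebra.single_mul_single]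
      rw [h]
      exact restrict_mem_generated φ ι _
  | one => rw [mul_one, mul_inv_cancel₀ hne]; exact one_mem _
  | add y z _ _ hy hz => rw [mul_add, add_mul]; exact add_mem hy hz
  | neg y _ hy => rw [mul_neg, neg_mul]; exact neg_mem hy
  | inv y _ hy =>
    have h : γ * y⁻¹ * γ⁻¹ = (γ * y * γ⁻¹)⁻¹ := by simp [mul_assoc]
    rw [h]
    exact inv_mem hy
  | mul y z _ _ hy hz =>
    have h : γ * (y * z) * γ⁻¹ = (γ * y * γ⁻¹) * (γ * z * γ⁻¹) := by
      simp only [mul_assoc, inv_mul_cancel_left₀ hne]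
    rw [h]
    exact mul_mem hy hz

variable {π : G →* Multiplicative ℤ} {t : G}

/-- In a Hughes-free division ring, the powers of an element generating the infinite cyclic
quotient are linearly independent over the skew-field of the kernel. -/
theorem IsHughesFree.linearIndependent_zpow (hφ : IsHughesFree φ) (hexact : ι.range = π.ker)
    (ht : π t = Multiplicative.ofAdd 1) :
    LinearIndependent (generated (HughesFree.restrict φ ι))
      fun i : ℤ => φ (MonoidAlgebra.of F G t) ^ i := by
  classical
  rw [linearIndependent_iff']
  intro s c hc j hj
  have hpow : ∀ i : ℤ, π (t ^ i) = Multiplicative.ofAdd i := fun i => by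
    rw [map_zpow, ht, ← ofAdd_zsmul]; simp
  -- Hughes-freeness speaks of finitely generated subgroups only, while `K` may be infinitely
  -- generated. A relation involves finitely many elements of `K`; with `t` they generate a subgroup
  -- `H` still mapping onto `ℤ`.
  choose S hS using fun i => exists_finset_mem_generated (c i).2
  let T : Finset G := insert t ((s.biUnion S).image ι)
  let H : Subgroup G := Subgroup.closure (T : Set G)
  have htH : t ∈ H := Subgroup.subset_closure (Finset.mem_insert_self _ _)
  have hιH : ∀ i ∈ s, ∀ k ∈ S i, ι k ∈ H := fun i hi k hk => Subgroup.subset_closure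
    (Finset.mem_insert_of_mem (Finset.mem_image_of_mem _ (Finset.mem_biUnion.2 ⟨i, hi, hk⟩)))
  let ρ : H →* Multiplicative ℤ := π.comp H.subtype
  have hρ : Function.Surjective ρ := fun z =>
    ⟨⟨t ^ z.toAdd, H.zpow_mem htH _⟩, hpow _⟩
  have hne : H ≠ ⊥ := by
    intro h
    rw [h, Subgroup.mem_bot] at htH
    rw [htH, map_one] at ht
    exact absurd (congrArg Multiplicative.toAdd ht) (by simp)
  let e := s.equivFin
  have key := hφ.direct H ⟨T, rfl⟩ hne ρ.ker
    ⟨QuotientGroup.quotientKerEquivOfSurjective ρ hρ⟩ s.card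
    (fun i => ⟨t ^ ((e.symm i : s) : ℤ), H.zpow_mem htH _⟩) (by
      intro i i' h
      have h1 := congrArg (QuotientGroup.kerLift ρ) h
      simp only [QuotientGroup.kerLift_mk] at h1
      have h2 : π (t ^ ((e.symm i : s) : ℤ)) = π (t ^ ((e.symm i' : s) : ℤ)) := h1
      rw [hpow, hpow] at h2
      exact e.symm.injective (Subtype.ext (Multiplicative.ofAdd.injective h2)))
    (fun i => (c (e.symm i : s) : D)) (by
      intro i
      refine hS _ _ fun k hk => ?_
      have hk1 : π (ι k) = 1 := by
        have : ι k ∈ ι.range := ⟨k, rfl⟩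
        rwa [hexact] at this
      exact ⟨⟨⟨ι k, hιH _ (e.symm i).2 k hk⟩, hk1⟩, rfl⟩) (by
      rw [← hc, ← Finset.sum_coe_sort s, ← e.symm.sum_comp]
      exact Finset.sum_congr rfl fun i _ => by
        rw [map_of_zpow, Subfield.smul_def, smul_eq_mul]) (e ⟨j, hj⟩)
  simp only [Equiv.symm_apply_apply] at key
  exact Subtype.ext ((mul_eq_zero.1 key).resolve_right (map_of_ne_zero φ _))

theorem exists_eq_mul_zpow (hexact : ι.range = π.ker) (ht : π t = Multiplicative.ofAdd 1)
    (g : G) : ∃ (k : K) (i : ℤ), g = ι k * t ^ i := by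
  have h : g * (t ^ (π g).toAdd)⁻¹ ∈ ι.range := by
    rw [hexact, MonoidHom.mem_ker, map_mul, map_inv, map_zpow, ht, ← ofAdd_zsmul]
    simp
  obtain ⟨k, hk⟩ := h
  exact ⟨k, _, by rw [hk, inv_mul_cancel_right]⟩

/-- `G` is the union of the cosets `ι(K) t ^ i`. This makes `exists_denominator` applicable to the
generators of `D`. -/
theorem range_subset_laurentSpan (hexact : ι.range = π.ker) (ht : π t = Multiplicative.ofAdd 1) :
    Set.range φ ⊆ laurentSpan (generated (restrict φ ι)) (φ (MonoidAlgebra.of F G t)) := by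
  rintro _ ⟨z, rfl⟩
  rw [SetLike.mem_coe]
  induction z using MonoidAlgebra.induction_linear with
  | zero => rw [map_zero]; exact Submodule.zero_mem _
  | add y z hy hz => rw [map_add]; exact Submodule.add_mem _ hy hz
  | single g a =>
    obtain ⟨k, i, rfl⟩ := exists_eq_mul_zpow hexact ht g
    have h : φ (MonoidAlgebra.single (ι k * t ^ i) a) =
        (⟨_, restrict_mem_generated φ ι (MonoidAlgebra.single k a)⟩ :
          generated (restrict φ ι)) • φ (MonoidAlgebra.of F G t) ^ i := by
      change _ = restrict φ ι (MonoidAlgebra.single k a) * φ (MonoidAlgebra.of F G t) ^ i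
      rw [restrict_single, ← map_of_zpow, ← map_mul, MonoidAlgebra.of_apply,
        MonoidAlgebra.single_mul_single, mul_one]
    rw [h]
    exact Submodule.smul_mem _ _ (zpow_mem_laurentSpan i)

end Cyclic

/-! ### Generators and universal property of the balanced tensor product -/

section BalancedTensor

variable {R : Type u} {D : Type w} [Ring R] [Ring D] (φ : R →+* D)
variable {M : Type x} [AddCommGroup M] [Module R M]

/-- The class of `d ⊗ m` in `D ⊗_R M`. -/
def balancedTmul (d : D) (m : M) : BalancedTensor φ M :=
  Submodule.Quotient.mk (d ⊗ₜ[ℤ] m)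

theorem balancedTmul_add (d : D) (m n : M) :
    balancedTmul φ d (m + n) = balancedTmul φ d m + balancedTmul φ d n := by
  rw [balancedTmul, TensorProduct.tmul_add]; rfl

theorem smul_balancedTmul (d d' : D) (m : M) :
    d • balancedTmul φ d' m = balancedTmul φ (d * d') m := rfl

theorem balancedTmul_eq_smul_one (d : D) (m : M) :
    balancedTmul φ d m = d • balancedTmul φ 1 m := by
  rw [smul_balancedTmul, mul_one]

theorem balancedTmul_smul (d : D) (r : R) (m : M) :
    balancedTmul φ d (r • m) = balancedTmul φ (d * φ r) m :=
  ((Submodule.Quotient.eq (balancing φ M)).2 (Submodule.subset_span ⟨d, r, m, rfl⟩)).symm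

/-- The additive map `m ↦ 1 ⊗ m`. -/
def oneTmul (M : Type x) [AddCommGroup M] [Module R M] : M →+ BalancedTensor φ M :=
  AddMonoidHom.mk' (balancedTmul φ 1) (balancedTmul_add φ 1)

theorem oneTmul_smul (r : R) (m : M) : oneTmul φ M (r • m) = φ r • oneTmul φ M m := by
  change balancedTmul φ 1 (r • m) = φ r • balancedTmul φ 1 m
  rw [balancedTmul_smul, one_mul, balancedTmul_eq_smul_one]

theorem span_range_oneTmul : Submodule.span D (Set.range (oneTmul φ M)) = ⊤ := by
  rw [eq_top_iff]
  rintro z -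
  obtain ⟨z, rfl⟩ := Submodule.Quotient.mk_surjective _ z
  induction z using TensorProduct.induction_on with
  | zero => exact Submodule.zero_mem _
  | tmul d m =>
    change balancedTmul φ d m ∈ _
    rw [balancedTmul_eq_smul_one]
    exact Submodule.smul_mem _ _ (Submodule.subset_span ⟨m, rfl⟩)
  | add a b ha hb => exact Submodule.add_mem _ ha hb

theorem balancedMap_oneTmul {N : Type x} [AddCommGroup N] [Module R N] (f : M →ₗ[R] N) (m : M) :
    balancedMap φ f (oneTmul φ M m) = oneTmul φ N (f m) := rfl

variable {V : Type*} [AddCommGroup V] [Module D V]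

/-- The `D`-linear map `D ⊗_R M → V` sending `d ⊗ m` to `d • g m`. -/
def balancedLift (g : M →+ V) (hg : ∀ (r : R) (m : M), g (r • m) = φ r • g m) :
    BalancedTensor φ M →ₗ[D] V :=
  Submodule.liftQ _
    (TensorProduct.AlgebraTensorModule.lift
      (LinearMap.toSpanSingleton D (M →ₗ[ℤ] V) g.toIntLinearMap)) (by
    refine Submodule.span_le.2 ?_
    rintro _ ⟨d, r, m, rfl⟩
    simp [hg, mul_smul])

theorem balancedLift_oneTmul (g : M →+ V) (hg : ∀ (r : R) (m : M), g (r • m) = φ r • g m)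
    (m : M) : balancedLift φ g hg (oneTmul φ M m) = g m := by
  change (1 : D) • g m = g m
  rw [one_smul]

theorem balanced_hom_ext_oneTmul {f g : BalancedTensor φ M →ₗ[D] V}
    (h : ∀ m : M, f (oneTmul φ M m) = g (oneTmul φ M m)) : f = g :=
  LinearMap.ext_on_range (span_range_oneTmul φ) h

end BalancedTensor

/-! ### Comparing tensor products over the two group rings -/

section Comparison

variable {R : Type u} {S : Type v} {D : Type w} [Ring R] [Ring S] [DivisionRing D] [Module R S]
  {E : Subfield D} (φ : S →+* D) (ψ : R →+* E) (hψ : ∀ r : R, (ψ r : D) = φ (r • (1 : S)))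

/-- The `E`-linear map `E ⊗_R M → D ⊗_S M`. -/
def comparison (M : Type x) [AddCommGroup M] [Module S M] [Module R M] [IsScalarTower R S M] :
    BalancedTensor ψ M →ₗ[E] BalancedTensor φ M :=
  balancedLift ψ (oneTmul φ M) fun r m => by
    rw [Subfield.smul_def, hψ, ← oneTmul_smul, smul_one_smul]

variable {M N : Type x} [AddCommGroup M] [Module S M] [Module R M] [IsScalarTower R S M]
  [AddCommGroup N] [Module S N] [Module R N] [IsScalarTower R S N]

theorem comparison_oneTmul (m : M) :
    comparison φ ψ hψ M (oneTmul ψ M m) = oneTmul φ M m :=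
  balancedLift_oneTmul ψ _ _ m

theorem comparison_balancedMap (g : M →ₗ[S] N) (g' : M →ₗ[R] N) (hg : ∀ m, g' m = g m)
    (c : BalancedTensor ψ M) :
    comparison φ ψ hψ N (balancedMap ψ g' c) = balancedMap φ g (comparison φ ψ hψ M c) := by
  have h : comparison φ ψ hψ N ∘ₗ balancedMap ψ g' =
      (balancedMap φ g).restrictScalars E ∘ₗ comparison φ ψ hψ M := by
    refine balanced_hom_ext_oneTmul ψ fun m => ?_
    rw [LinearMap.comp_apply, LinearMap.comp_apply, LinearMap.restrictScalars_apply,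
      balancedMap_oneTmul, comparison_oneTmul, comparison_oneTmul, balancedMap_oneTmul, hg]
  exact LinearMap.congr_fun h c

theorem range_comparison :
    LinearMap.range (comparison φ ψ hψ M) = Submodule.span E (Set.range (oneTmul φ M)) := by
  rw [LinearMap.range_eq_map, ← span_range_oneTmul, Submodule.map_span, ← Set.range_comp]
  congr 1
  exact congrArg Set.range (funext fun m => comparison_oneTmul φ ψ hψ m)

variable {J : Type*} (β : Module.Basis J R S)

theorem span_range_oneTmul_single (I : Type*) :
    Submodule.span E (Set.range fun q : Σ _ : I, J =>
      oneTmul ψ (I →₀ S) (Finsupp.single q.1 (β q.2))) = ⊤ := by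
  rw [eq_top_iff, ← span_range_oneTmul, Submodule.span_le]
  rintro _ ⟨m, rfl⟩
  rw [SetLike.mem_coe]
  induction m using Finsupp.induction_linear with
  | zero => rw [map_zero]; exact Submodule.zero_mem _
  | add y z hy hz => rw [map_add]; exact Submodule.add_mem _ hy hz
  | single a s =>
    have hs : s ∈ Submodule.span R (Set.range β) := by rw [β.span_eq]; trivial
    induction hs using Submodule.span_induction with
    | mem y hy =>
      obtain ⟨i, rfl⟩ := hy
      exact Submodule.subset_span ⟨⟨a, i⟩, rfl⟩
    | zero => rw [Finsupp.single_zero, map_zero]; exact Submodule.zero_mem _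
    | add y z _ _ hy hz =>
      rw [Finsupp.single_add, map_add]; exact Submodule.add_mem _ hy hz
    | smul r y _ hy =>
      rw [← Finsupp.smul_single, oneTmul_smul]
      exact Submodule.smul_mem _ _ hy

variable [IsScalarTower R S S]

/-- The elements `1 ⊗ single a (β i)` span the source over `E`. In `I →₀ D` they become `single a (φ
(β i))`, which are independent over `E`; a linear map carrying a spanning family to an independent
one is injective. -/
theorem comparison_injective_of_free (hβ : LinearIndependent E fun i => φ (β i)) (I : Type*) :
    Function.Injective (comparison φ ψ hψ (I →₀ S)) := by
  let Φ : BalancedTensor φ (I →₀ S) →ₗ[D] (I →₀ D) := balancedLift φ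
    (Finsupp.mapRange.addMonoidHom φ.toAddMonoidHom) (by
      intro r m
      ext a
      simp)
  have hΦ : ∀ l : I →₀ S, Φ (oneTmul φ _ l) = Finsupp.mapRange φ (map_zero φ) l :=
    fun l => balancedLift_oneTmul φ _ _ l
  let b : (Σ _ : I, J) → BalancedTensor ψ (I →₀ S) := fun q =>
    oneTmul ψ _ (Finsupp.single q.1 (β q.2))
  have hb : LinearIndependent E (comparison φ ψ hψ (I →₀ S) ∘ b) := by
    refine LinearIndependent.of_comp (Φ.restrictScalars E) ?_
    have h := Finsupp.linearIndependent_single (R := E) (fun (_ : I) (i : J) => φ (β i))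
      fun _ => hβ
    have hfun : Φ.restrictScalars E ∘ comparison φ ψ hψ (I →₀ S) ∘ b =
        fun q : Σ _ : I, J => Finsupp.single q.1 (φ (β q.2)) := ?_
    · rw [hfun]
      exact h
    funext q
    change Φ (comparison φ ψ hψ (I →₀ S) (oneTmul ψ _ _)) = _
    rw [comparison_oneTmul, hΦ, Finsupp.mapRange_single]
  rw [injective_iff_map_eq_zero]
  intro c hc
  obtain ⟨l, rfl⟩ : ∃ l : (Σ _ : I, J) →₀ E, Finsupp.linearCombination E b l = c := by
    rw [← LinearMap.mem_range, Finsupp.range_linearCombination, span_range_oneTmul_single]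
    trivial
  rw [Finsupp.apply_linearCombination] at hc
  rw [linearIndependent_iff.1 hb l hc, map_zero]

/-- A projective module is a retract of a free one, and the comparison map is natural, so
injectivity passes to the retract. -/
theorem comparison_injective (hβ : LinearIndependent E fun i => φ (β i))
    (M : Type max v x) [AddCommGroup M] [Module S M] [Module R M] [IsScalarTower R S M]
    [Module.Projective S M] : Function.Injective (comparison φ ψ hψ M) := by
  obtain ⟨s, hs⟩ := Module.Projective.out (R := S) (P := M)
  rw [injective_iff_map_eq_zero]
  intro c hc
  have h1 := comparison_balancedMap φ ψ hψ s (s.restrictScalars R) (fun _ => rfl) c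
  rw [hc, map_zero, ← map_zero (comparison φ ψ hψ (M →₀ S))] at h1
  have h2 := comparison_injective_of_free φ ψ hψ β hβ M h1
  have h3 : balancedMap ψ ((Finsupp.linearCombination S (id : M → M)).restrictScalars R) ∘ₗ
      balancedMap ψ (s.restrictScalars R) = LinearMap.id := by
    refine balanced_hom_ext_oneTmul ψ fun m => ?_
    rw [LinearMap.comp_apply, balancedMap_oneTmul, balancedMap_oneTmul]
    exact congrArg (oneTmul ψ M) (hs m)
  have h4 := LinearMap.congr_fun h3 c
  rw [LinearMap.comp_apply, h2, map_zero] at h4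
  exact h4.symm

/-- A module which is projective over `S` is projective over `R` if `S` is free over `R`. -/
theorem projective_of_basis {R : Type u} {S : Type v} [Ring R] [Ring S] [Module R S]
    {J : Type*} (β : Module.Basis J R S) (M : Type x)
    [AddCommGroup M] [Module S M] [Module R M] [IsScalarTower R S M] [IsScalarTower R S S]
    [Module.Projective S M] : Module.Projective R M := by
  obtain ⟨s, hs⟩ := Module.Projective.out (R := S) (P := M)
  have := Module.Free.of_basis β
  exact Module.Projective.of_split (s.restrictScalars R)
    ((Finsupp.linearCombination S (id : M → M)).restrictScalars R) (LinearMap.ext hs)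

end Comparison

/-! ### Restriction of scalars and projective resolutions -/

section Restriction

variable {R : Type u} {S : Type v} [Ring R] [Ring S] (f : R →+* S)

theorem restrictScalars_map_exact (T : ShortComplex (ModuleCat.{x} S)) (h : T.Exact) :
    (T.map (ModuleCat.restrictScalars.{x} f)).Exact := by
  rw [ShortComplex.ShortExact.moduleCat_exact_iff_function_exact] at h ⊢
  exact h

theorem restrictScalars_preservesHomology :
    (ModuleCat.restrictScalars.{x} f).PreservesHomology :=
  ((Functor.exact_tfae (ModuleCat.restrictScalars.{x} f)).out 1 2).mp
    (restrictScalars_map_exact f)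

theorem restrictScalars_preservesProjectiveObjects [Module R S] [IsScalarTower R S S]
    (hf : ∀ r : R, r • (1 : S) = f r) {J : Type*} (β : Module.Basis J R S) :
    (ModuleCat.restrictScalars.{max u v x} f).PreservesProjectiveObjects where
  projective_obj {M} hM := by
    have : Module.Projective S M := ModuleCat.projective_of_module_projective M
    let _ : Module R M := Module.compHom M f
    have : IsScalarTower R S M := ⟨fun r s m => by
      change (r • s) • m = f r • s • m
      rw [← hf, smul_smul, smul_one_mul]⟩
    have : Module.Projective R ((ModuleCat.restrictScalars f).obj M) :=
      projective_of_basis β M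
    exact ModuleCat.projective_of_categoryTheory_projective _

end Restriction

/-! ### Exactness over `D` from finite-dimensional homology over `E` -/

section Exactness

variable {R : Type u} {S : Type v} {D : Type w} [Ring R] [Ring S] [DivisionRing D]

/-- If the homology of a short complex of vector spaces is finite-dimensional, then every sequence
of cycles has a nontrivial linear combination which is a boundary. -/
theorem exists_relation_of_finite_homology {E : Type*} [DivisionRing E]
    (T : ShortComplex (ModuleCat.{x} E)) [Module.Finite E T.homology] (c : ℕ → T.X₂)
    (hc : ∀ i, T.g.hom (c i) = 0) :
    ∃ (s : Finset ℕ) (e : ℕ → E), (∃ i ∈ s, e i ≠ 0) ∧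
      ∃ b : T.X₁, T.f.hom b = ∑ i ∈ s, e i • c i := by
  let Q := LinearMap.ker T.g.hom ⧸ LinearMap.range T.moduleCatToCycles
  have : Module.Finite E Q := Module.Finite.equiv T.moduleCatHomologyIso.toLinearEquiv
  let q : ℕ → Q := fun i => Submodule.Quotient.mk ⟨c i, hc i⟩
  have hq : ¬ LinearIndependent E q := Module.Finite.not_linearIndependent_of_infinite q
  rw [not_linearIndependent_iff] at hq
  obtain ⟨s, e, hsum, hne⟩ := hq
  refine ⟨s, e, hne, ?_⟩
  have h : (Submodule.Quotient.mk (∑ i ∈ s, e i • (⟨c i, hc i⟩ : LinearMap.ker T.g.hom)) : Q)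
      = 0 := by
    rw [← hsum, ← Submodule.mkQ_apply, map_sum]
    rfl
  rw [Submodule.Quotient.mk_eq_zero] at h
  obtain ⟨b, hb⟩ := h
  refine ⟨b, ?_⟩
  have := congrArg (LinearMap.ker T.g.hom).subtype hb
  rw [map_sum] at this
  exact this

variable {E : Subfield D} {φ : S →+* D} {ψ : R →+* E} {τ : D}

theorem zpow_smul_mem_span_oneTmul {b : ℤ → S} (hb : ∀ i, φ (b i) = τ ^ i) (hτ : τ ≠ 0)
    (hconj : ∀ (i : ℤ), ∀ e ∈ E, τ ^ i * e * (τ ^ i)⁻¹ ∈ E)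
    (M : Type x) [AddCommGroup M] [Module S M] (i : ℤ) {z : BalancedTensor φ M}
    (hz : z ∈ Submodule.span E (Set.range (oneTmul φ M))) :
    τ ^ i • z ∈ Submodule.span E (Set.range (oneTmul φ M)) := by
  refine zpow_smul_mem_span hτ hconj ?_ i hz
  rintro i _ ⟨m, rfl⟩
  refine Submodule.subset_span ⟨b i • m, ?_⟩
  rw [oneTmul_smul, hb]

/-- Elements of `D ⊗_S M` have denominators in the twisted Laurent polynomial ring. -/
theorem exists_smul_mem_span_oneTmul {b : ℤ → S} (hb : ∀ i, φ (b i) = τ ^ i) (hτ : τ ≠ 0)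
    (hconj : ∀ (i : ℤ), ∀ e ∈ E, τ ^ i * e * (τ ^ i)⁻¹ ∈ E)
    (hind : LinearIndependent E fun i : ℤ => τ ^ i)
    (hrange : Set.range φ ⊆ laurentSpan E τ) (hgen : generated φ = ⊤)
    (M : Type x) [AddCommGroup M] [Module S M] (z : BalancedTensor φ M) :
    ∃ a ∈ laurentSpan E τ, a ≠ 0 ∧ a • z ∈ Submodule.span E (Set.range (oneTmul φ M)) := by
  have hL := fun (i : ℤ) (l : BalancedTensor φ M) hl =>
    zpow_smul_mem_span_oneTmul (E := E) hb hτ hconj M i (z := l) hl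
  have hz : z ∈ Submodule.span D (Set.range (oneTmul φ M)) := by
    rw [span_range_oneTmul]; trivial
  induction hz using Submodule.span_induction with
  | mem y hy =>
    exact ⟨1, one_mem_laurentSpan, one_ne_zero, by
      rw [one_smul]; exact Submodule.subset_span hy⟩
  | zero => exact ⟨1, one_mem_laurentSpan, one_ne_zero, by
      rw [smul_zero]; exact Submodule.zero_mem _⟩
  | add y z _ _ hy hz =>
    obtain ⟨a, ha, ha0, hay⟩ := hy
    obtain ⟨b, hb, hb0, hbz⟩ := hz
    obtain ⟨c, hc, d, hd, hc0, h⟩ := laurentSpan_ore hτ hconj hind ha hb hb0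
    refine ⟨c * a, laurentSpan_mul_mem hτ hconj hc ha, mul_ne_zero hc0 ha0, ?_⟩
    rw [smul_add, mul_smul c a y, h, mul_smul d b z]
    exact Submodule.add_mem _ (laurentSpan_smul_mem hL hc hay) (laurentSpan_smul_mem hL hd hbz)
  | smul d y _ hy =>
    obtain ⟨a, ha, ha0, hay⟩ := hy
    have hd : d ∈ Subfield.closure (Set.range φ) := by
      change d ∈ generated φ
      rw [hgen]; trivial
    obtain ⟨b, hb, hb0, hbd⟩ := exists_denominator hτ hconj hind hrange hd
    -- From `c * (b * d) = d' * a` it follows that `c * b` carries `d • y` to `d' • (a • y)`. Here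
    -- `b * d` may vanish; only `a` has to be nonzero.
    obtain ⟨c, hc, d', hd', hc0, h⟩ := laurentSpan_ore hτ hconj hind hbd ha ha0
    refine ⟨c * b, laurentSpan_mul_mem hτ hconj hc hb, mul_ne_zero hc0 hb0, ?_⟩
    rw [smul_smul, mul_assoc, h, mul_smul]
    exact laurentSpan_smul_mem hL hd' hay

/-- Let `S` be free over `R` on elements mapping to the powers of `τ`. If the homology of
`E ⊗_R T` is finite-dimensional over `E`, then `D ⊗_S T` is exact. -/
theorem exact_of_finite_homology (f : R →+* S) [Module R S] [IsScalarTower R S S]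
    (hf : ∀ r : R, r • (1 : S) = f r) (β : Module.Basis ℤ R S)
    (hψ : ∀ r : R, (ψ r : D) = φ (f r))
    (hβ : ∀ i, φ (β i) = τ ^ i) (hτ : τ ≠ 0)
    (hconj : ∀ (i : ℤ), ∀ e ∈ E, τ ^ i * e * (τ ^ i)⁻¹ ∈ E)
    (hind : LinearIndependent E fun i : ℤ => τ ^ i)
    (hrange : Set.range φ ⊆ laurentSpan E τ) (hgen : generated φ = ⊤)
    (T : ShortComplex (ModuleCat.{max v x} S)) [Module.Projective S T.X₃]
    [Module.Finite E ((T.map (ModuleCat.restrictScalars f)).map (tensorFunctor ψ)).homology] :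
    (T.map (tensorFunctor φ)).Exact := by
  have tower : ∀ (M : Type max v x) [AddCommGroup M] [Module S M],
      letI : Module R M := Module.compHom M f
      IsScalarTower R S M := fun M _ _ => by
    let _ : Module R M := Module.compHom M f
    refine ⟨fun r s m => ?_⟩
    change (r • s) • m = f r • s • m
    rw [← hf, smul_smul, smul_one_mul]
  let _ : Module R T.X₁ := Module.compHom T.X₁ f
  let _ : Module R T.X₂ := Module.compHom T.X₂ f
  let _ : Module R T.X₃ := Module.compHom T.X₃ f
  have := tower T.X₁
  have := tower T.X₂
  have := tower T.X₃
  have hψ' : ∀ r : R, (ψ r : D) = φ (r • (1 : S)) := fun r => by rw [hf, hψ]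
  let f' : T.X₁ →ₗ[R] T.X₂ := T.f.hom.restrictScalars R
  let g' : T.X₂ →ₗ[R] T.X₃ := T.g.hom.restrictScalars R
  have hinj : Function.Injective (comparison φ ψ hψ' T.X₃) :=
    comparison_injective φ ψ hψ' β (by simpa only [hβ] using hind) T.X₃
  rw [ShortComplex.moduleCat_exact_iff]
  change ∀ z : BalancedTensor φ T.X₂, balancedMap φ T.g.hom z = 0 →
    ∃ y : BalancedTensor φ T.X₁, balancedMap φ T.f.hom y = z
  intro z hz
  obtain ⟨a, -, ha0, haz⟩ :=
    exists_smul_mem_span_oneTmul hβ hτ hconj hind hrange hgen T.X₂ z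
  -- Nonnegative powers suffice: only an infinite family of cycles is needed.
  have hlift : ∀ i : ℕ, ∃ c, comparison φ ψ hψ' T.X₂ c = τ ^ (i : ℤ) • a • z := fun i => by
    rw [← LinearMap.mem_range, range_comparison]
    exact zpow_smul_mem_span_oneTmul hβ hτ hconj T.X₂ i haz
  choose c hc using hlift
  -- The lifts are cycles because the comparison map is injective one degree lower; this is the only
  -- use of projectivity.
  have hcycle : ∀ i, balancedMap ψ g' (c i) = 0 := fun i => by
    apply hinj
    rw [comparison_balancedMap φ ψ hψ' T.g.hom g' (fun _ => rfl), hc, map_smul, map_smul, hz,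
      smul_zero, smul_zero, map_zero]
  obtain ⟨s, e, ⟨i₀, hi₀, hne⟩, b, hb⟩ := exists_relation_of_finite_homology
    ((T.map (ModuleCat.restrictScalars f)).map (tensorFunctor ψ)) c hcycle
  obtain ⟨b, hb⟩ : ∃ b : BalancedTensor ψ T.X₁, balancedMap ψ f' b = ∑ i ∈ s, e i • c i :=
    ⟨b, hb⟩
  have hq := congrArg (comparison φ ψ hψ' T.X₂) hb
  rw [comparison_balancedMap φ ψ hψ' T.f.hom f' (fun _ => rfl), map_sum] at hq
  let q : D := ∑ i ∈ s, e i • τ ^ (i : ℤ)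
  have hq0 : q ≠ 0 := fun h0 => by
    have hind' : LinearIndependent E fun i : ℕ => τ ^ (i : ℤ) :=
      hind.comp (fun i : ℕ => (i : ℤ)) Nat.cast_injective
    exact hne (linearIndependent_iff'.1 hind' s e h0 i₀ hi₀)
  have hqz : ∑ i ∈ s, comparison φ ψ hψ' T.X₂ (e i • c i) = (q * a) • z := by
    rw [mul_smul, Finset.sum_smul]
    refine Finset.sum_congr rfl fun i _ => ?_
    rw [map_smul, hc, smul_assoc]
  refine ⟨(q * a)⁻¹ • comparison φ ψ hψ' T.X₁ b, ?_⟩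
  rw [map_smul, hq, hqz, inv_smul_smul₀ (mul_ne_zero hq0 ha0)]

end Exactness

/-! ### The group ring of an extension of `ℤ` -/

section GroupExtension

variable (F : Type u) {G K : Type v} [DivisionRing F] [Group G] [Group K]

theorem augmentation_comp_mapDomain (ι : K →* G) :
    (augmentation F G).comp (MonoidAlgebra.mapDomainRingHom F ι) = augmentation F K := by
  refine MonoidAlgebra.ringHom_ext (fun a => ?_) fun k => ?_ <;> simp [augmentation]

/-- The trivial module restricts to the trivial module. -/
def restrictTrivialModule (ι : K →* G) :
    (ModuleCat.restrictScalars (MonoidAlgebra.mapDomainRingHom F ι)).obj (trivialModule F G) ≅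
      trivialModule F K :=
  let e : (ModuleCat.restrictScalars (MonoidAlgebra.mapDomainRingHom F ι)).obj
      (trivialModule F G) ≃ₗ[MonoidAlgebra F K] trivialModule F K :=
    { AddEquiv.refl (ULift.{v} F) with
      map_smul' := fun r y =>
        congrArg (fun h : MonoidAlgebra F K →+* F => h r • (show ULift.{v} F from y))
          (augmentation_comp_mapDomain F ι) }
  e.toModuleIso

variable {ι : K →* G} {π : G →* Multiplicative ℤ} {t : G}

/-- The map `π` recovers the exponent of `t`, so distinct cosets `ι(K) t ^ i` are disjoint and
coefficients can be read off coset by coset. -/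
theorem coeff_mapDomain_mul_zpow (hι : Function.Injective ι) (hexact : ι.range = π.ker)
    (ht : π t = Multiplicative.ofAdd 1) (r : MonoidAlgebra F K) (i j : ℤ) (k : K) :
    (MonoidAlgebra.mapDomainRingHom F ι r * MonoidAlgebra.of F G (t ^ i)).coeff (ι k * t ^ j) =
      if i = j then r.coeff k else 0 := by
  rw [MonoidAlgebra.of_apply, MonoidAlgebra.coeff_mul_single_apply, mul_one,
    MonoidAlgebra.mapDomainRingHom_apply, MonoidAlgebra.coeff_mapDomain]
  split_ifs with h
  · rw [h, mul_inv_cancel_right, Finsupp.mapDomain_apply hι]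
  · refine Finsupp.mapDomain_of_notMem_range _ _ ?_
    rintro ⟨l, hl⟩
    have hk : ∀ k : K, π (ι k) = 1 := fun k => by
      have : ι k ∈ ι.range := ⟨k, rfl⟩
      rwa [hexact] at this
    have := congrArg π hl
    rw [hk, map_mul, map_mul, hk, map_inv, map_zpow, map_zpow, ht, ← ofAdd_zsmul, ← ofAdd_zsmul,
      one_mul, ← ofAdd_neg, ← ofAdd_add] at this
    have := congrArg Multiplicative.toAdd this
    simp at this
    omega

/-- For a group extension of `ℤ` by `K`, the group ring `F[G]` is free over `F[K]` on the powers
of an element lifting a generator. -/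
theorem exists_basis_zpow (hι : Function.Injective ι) (hexact : ι.range = π.ker)
    (ht : π t = Multiplicative.ofAdd 1) :
    letI : Module (MonoidAlgebra F K) (MonoidAlgebra F G) :=
      Module.compHom _ (MonoidAlgebra.mapDomainRingHom F ι)
    ∃ β : Module.Basis ℤ (MonoidAlgebra F K) (MonoidAlgebra F G),
      ∀ i, β i = MonoidAlgebra.of F G (t ^ i) := by
  let _ : Module (MonoidAlgebra F K) (MonoidAlgebra F G) :=
      Module.compHom _ (MonoidAlgebra.mapDomainRingHom F ι)
  have hsmul : ∀ (r : MonoidAlgebra F K) (s : MonoidAlgebra F G),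
      r • s = MonoidAlgebra.mapDomainRingHom F ι r * s := fun _ _ => rfl
  have hli : LinearIndependent (MonoidAlgebra F K) fun i : ℤ => MonoidAlgebra.of F G (t ^ i) := by
    rw [linearIndependent_iff']
    intro s c hc j hj
    ext k
    have h := congrArg (fun z : MonoidAlgebra F G => z.coeff (ι k * t ^ j)) hc
    simp only [hsmul, MonoidAlgebra.coeff_sum, Finsupp.finsetSum_apply,
      coeff_mapDomain_mul_zpow F hι hexact ht, Finset.sum_ite_eq', hj, if_true] at h
    exact h
  have hsp : ⊤ ≤ Submodule.span (MonoidAlgebra F K)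
      (Set.range fun i : ℤ => MonoidAlgebra.of F G (t ^ i)) := by
    rintro z -
    induction z using MonoidAlgebra.induction_linear with
    | zero => exact Submodule.zero_mem _
    | add y z hy hz => exact Submodule.add_mem _ hy hz
    | single g a =>
      obtain ⟨k, i, rfl⟩ := exists_eq_mul_zpow hexact ht g
      have h : MonoidAlgebra.single (ι k * t ^ i) a =
          (MonoidAlgebra.single k a : MonoidAlgebra F K) • MonoidAlgebra.of F G (t ^ i) := by
        rw [hsmul]
        simp [MonoidAlgebra.single_mul_single]
      rw [h]
      exact Submodule.smul_mem _ _ (Submodule.subset_span ⟨i, rfl⟩)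
  exact ⟨Module.Basis.mk hli hsp, fun i => Module.Basis.mk_apply hli hsp i⟩

end GroupExtension

end HughesFree

end

/-! ### Vanishing of the Betti number -/

theorem mainTheorem6 {F : Type u} {G K : Type v} {D : Type w}
    [DivisionRing F] [Group G] [Group K] [DivisionRing D]
    (hG : HughesFree.LocallyIndicable G)
    (φ : MonoidAlgebra F G →+* D) (hφ : HughesFree.IsHughesFree φ)
    (ι : K →* G) (π : G →* Multiplicative ℤ)
    (hι : Function.Injective ι) (hexact : ι.range = π.ker) (hπ : Function.Surjective π)
    (p : ℕ)
    (hfin : HughesFree.betti (HughesFree.toGenerated (HughesFree.restrict φ ι)) p < ⊤) :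
    HughesFree.betti φ p = 0 := by
  open HughesFree in
  obtain ⟨t, ht⟩ := hπ (Multiplicative.ofAdd 1)
  let f := MonoidAlgebra.mapDomainRingHom F ι
  let ψ := toGenerated (restrict φ ι)
  let _ : Module (MonoidAlgebra F K) (MonoidAlgebra F G) := Module.compHom _ f
  have : IsScalarTower (MonoidAlgebra F K) (MonoidAlgebra F G) (MonoidAlgebra F G) :=
    ⟨fun r s z => mul_assoc (f r) s z⟩
  have hf : ∀ r : MonoidAlgebra F K, r • (1 : MonoidAlgebra F G) = f r := fun r => mul_one (f r)
  obtain ⟨β, hβ⟩ := exists_basis_zpow F hι hexact ht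
  have hproj := restrictScalars_preservesProjectiveObjects.{max u v, max u v, max u v} f hf β
  have hhom := restrictScalars_preservesHomology.{max u v, max u v, max u v} f
  let P : ProjectiveResolution (trivialModule F G) := projectiveResolution _
  let Q := (ModuleCat.restrictScalars f).mapProjectiveResolution P
  let eG : homology φ p ≅ ((P.complex.sc p).map (tensorFunctor φ)).homology :=
    P.isoLeftDerivedObj (tensorFunctor φ) p
  -- The restriction of `P` to `F[K]` is a projective resolution of the restricted trivial module,
  -- so one complex computes both homologies.
  let eK : homology ψ p ≅
      (((P.complex.sc p).map (ModuleCat.restrictScalars f)).map (tensorFunctor ψ)).homology :=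
    ((tensorFunctor ψ).leftDerived p).mapIso (restrictTrivialModule F ι).symm ≪≫
      Q.isoLeftDerivedObj (tensorFunctor ψ) p
  have hfinite : Module.Finite (generated (restrict φ ι)) (homology ψ p) := by
    rw [← Module.rank_lt_aleph0_iff, ← Cardinal.toENat_lt_top]
    exact hfin
  have : Module.Finite (generated (restrict φ ι))
      (((P.complex.sc p).map (ModuleCat.restrictScalars f)).map (tensorFunctor ψ)).homology :=
    Module.Finite.equiv eK.toLinearEquiv
  have hnormal : ι.range.Normal := hexact ▸ π.normal_ker
  -- For `p = 0` the default `next 0 = 0` makes this term `P₀` again, with zero differential; it is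
  -- projective in every case.
  have : Module.Projective (MonoidAlgebra F G) (P.complex.sc p).X₃ :=
    have := P.projective ((ComplexShape.down ℕ).next p)
    ModuleCat.projective_of_module_projective (P.complex.X ((ComplexShape.down ℕ).next p))
  have hexactness : ((P.complex.sc p).map (tensorFunctor φ)).Exact :=
    exact_of_finite_homology.{max u v, max u v, w, max u v} (ψ := ψ) f hf β (fun _ => rfl)
      (fun i => by rw [hβ, map_of_zpow]) (map_of_ne_zero φ t)
      (fun i e he => by
        rw [← map_of_zpow]
        exact conj_mem_generated hnormal _ he)
      (hφ.linearIndependent_zpow hexact ht) (range_subset_laurentSpan hexact ht)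
      hφ.generated_eq_top _
  have hzero : Limits.IsZero (homology φ p) :=
    ((ShortComplex.exact_iff_isZero_homology _).1 hexactness).of_iso eG
  have := ModuleCat.subsingleton_of_isZero hzero
  rw [betti, Cardinal.toENat_eq_zero]
  exact rank_subsingleton' _ _
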